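/- Let $k_Z,k_W,\theta_Z,\theta_W,\rho,\zeta>0$ be real numbers, and suppose that the signal-to-interference-and-noise ratio (SINR) $\gamma$ of a center user is a random variable with the beta prime distribution with shape parameters $k_Z,k_W$ and scale $\sigma=\rho\zeta\theta_Z/\theta_W$, i.e. with density $$f_\gamma(x)=\frac{(x/\sigma)^{k_Z-1}\,(1+x/\sigma)^{-(k_Z+k_W)}}{\sigma\,B(k_Z,k_W)}\quad(x>0),\qquad f_\gamma(x)=0\quad(x\le 0),$$ where $B$ is the Euler Beta function. Then the integral defining the ergodic rate $$\mathcal R=\int_0^\infty \log_2(1+x)\,f_\gamma(x)\,dx$$ converges absolutely, and $$\mathcal R=\frac{1}{\ln(2)\,\Lambda}\;G^{3,2}_{3,3}\!\left(\frac{\theta_W}{\rho\zeta\theta_Z}\,\middle|\,\begin{matrix}0,\;1-k_W,\;1\\ 0,\;0,\;k_Z\end{matrix}\right),\qquad \Lambda=B(k_Z,k_W)\,\Gamma(k_Z+k_W).$$ Here $G^{m,n}_{p,q}$ is the Meijer G-function $$G^{m,n}_{p,q}\!\left(z\,\middle|\,\begin{matrix}a_1,\dots,a_p\\ b_1,\dots,b_q\end{matrix}\right)=\frac1{2\pi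 i}\int_{c-i\infty}^{c+i\infty}\frac{\prod_{j=1}^m\Gamma(b_j-s)\prod_{j=1}^n\Gamma(1-a_j+s)}{\prod_{j=m+1}^q\Gamma(1-b_j+s)\prod_{j=n+1}^p\Gamma(a_j-s)}\,z^s\,ds,$$ where the line $\operatorname{Re}s=c$ has the poles of $\Gamma(b_j-s)$, $1\le j\le m$, on its right and the poles of $\Gamma(1-a_j+s)$, $1\le j\le n$, on its left. For the parameters above such lines exist (those with $-\min(1,k_W)<c<0$), and along each of them the integral converges absolutely, with the same value. -/

import Mathlib

open MeasureTheory ProbabilityTheory Set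

noncomputable section

/-- Mellin–Barnes integrand of the Meijer G-function `G^{m,n}_{p,q}(z | a; b)`:
`∏_{j ≤ m} Γ(b_j - s) ∏_{j ≤ n} Γ(1 - a_j + s) /
  (∏_{j > m} Γ(1 - b_j + s) ∏_{j > n} Γ(a_j - s)) * z ^ s`.
Since `Complex.Gamma` is `0` at its poles and `0⁻¹ = 0`, the inverses below are the entire function
`1 / Γ`. -/
def meijerGIntegrand {p q : ℕ} (m n : ℕ) (a : Fin p → ℂ) (b : Fin q → ℂ) (z s : ℂ) : ℂ :=
  (∏ j : Fin q,
      if (j : ℕ) < m then Complex.Gamma (b j - s) else (Complex.Gamma (1 - b j + s))⁻¹) *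
    (∏ j : Fin p,
      if (j : ℕ) < n then Complex.Gamma (1 - a j + s) else (Complex.Gamma (a j - s))⁻¹) *
    z ^ s

/-- The line `Re s = c`, run upwards, separates the poles `b_j + k` (`j ≤ m`, `k ≥ 0`), which lie to
its right, from the poles `a_j - 1 - k` (`j ≤ n`, `k ≥ 0`), which lie to its left. -/
def MeijerGSeparates {p q : ℕ} (m n : ℕ) (a : Fin p → ℂ) (b : Fin q → ℂ) (c : ℝ) : Prop :=
  (∀ j : Fin q, (j : ℕ) < m → c < (b j).re) ∧ (∀ j : Fin p, (j : ℕ) < n → (a j).re - 1 < c)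

/-- `w` is the value of the Meijer G-function `G^{m,n}_{p,q}(z | a; b)`, with a contour
`c - i∞ → c + i∞`: separating lines exist, and along each of them the Mellin–Barnes integral
`(1 / 2πi) ∫ … ds` converges absolutely with value `w` (with `s = c + i t`, `ds = i dt`). -/
def HasMeijerG {p q : ℕ} (m n : ℕ) (a : Fin p → ℂ) (b : Fin q → ℂ) (z w : ℂ) : Prop :=
  (∃ c : ℝ, MeijerGSeparates m n a b c) ∧
    ∀ c : ℝ, MeijerGSeparates m n a b c →
      Integrable (fun t : ℝ => meijerGIntegrand m n a b z (c + t * Complex.I)) ∧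
      1 / (2 * Real.pi) * ∫ t : ℝ, meijerGIntegrand m n a b z (c + t * Complex.I) = w

open Classical in
/-- The Meijer G-function `G^{m,n}_{p,q}(z | a; b)` (with value `0` where the defining
Mellin–Barnes integral along vertical separating lines does not exist). -/
def meijerG {p q : ℕ} (m n : ℕ) (a : Fin p → ℂ) (b : Fin q → ℂ) (z : ℂ) : ℂ :=
  if h : ∃ w, HasMeijerG m n a b z w then h.choose else 0

/-- Density of the beta prime distribution `β'(k₁, k₂, 1, σ)` with shape parameters `k₁`, `k₂` and
scale `σ`. Here `ProbabilityTheory.beta` is the Euler Beta function. -/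
def betaPrimePDFReal (k₁ k₂ σ x : ℝ) : ℝ :=
  if 0 < x then (x / σ) ^ (k₁ - 1) * (x / σ + 1) ^ (-(k₁ + k₂)) / (σ * beta k₁ k₂) else 0

/-- The beta prime distribution with shape parameters `k₁`, `k₂` and scale `σ`. -/
def betaPrimeMeasure (k₁ k₂ σ : ℝ) : Measure ℝ :=
  volume.withDensity fun x => ENNReal.ofReal (betaPrimePDFReal k₁ k₂ σ x)

/-- The integrand `log₂(1 + x) f_γ(x)` of the ergodic rate, `f_γ` being the density of `γ`. -/
def ergodicRateIntegrand {Ω : Type*} [MeasurableSpace Ω] (γ : Ω → ℝ) (P : Measure Ω) (x : ℝ) : ℝ :=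
  Real.logb 2 (1 + x) * (pdf γ P volume x).toReal

/-- The ergodic rate `∫₀^∞ log₂(1 + x) f_γ(x) dx` of a user with SINR `γ`. -/
def ergodicRate {Ω : Type*} [MeasurableSpace Ω] (γ : Ω → ℝ) (P : Measure Ω) : ℝ :=
  ∫ x in Ioi (0 : ℝ), ergodicRateIntegrand γ P x

end

section

open Complex Filter Topology

/-! Up to the factor `1 / ln 2`, the rate is `∫ log (1 + x) f(x) dx`, which Mellin–Parseval
(`mellin_parseval`) turns into a Mellin–Barnes integral along `Re s = c`. For `-1 < Re s < 0` the
transform of `log (1 + x)` at `s` is `-Γ(1 + s) Γ(-s) / s` (`hasMellin_log_one_add`). For `-k_W < Re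
s < k_Z` that of the density at `1 - s` is `σ^(-s) Γ(k_Z - s) Γ(k_W + s) / Λ`
(`hasMellin_betaPrimePDFReal`). As `-1 / s = Γ(-s) / Γ(1 - s)`, `Λ` times their product is the
Meijer integrand at `z = 1 / σ`. Separating lines are exactly those with `-min(1, k_W) < c < 0`.
Parseval applies on each and gives the same real integral, so no contour is shifted. -/

/-! ### Beta integral of the second kind -/

theorem image_div_one_add_Ioi : (fun x : ℝ => x / (1 + x)) '' Ioi 0 = Ioo 0 1 := by
  ext u
  constructor
  · rintro ⟨x, hx, rfl⟩
    have hx : 0 < x := hx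
    exact ⟨by positivity, (div_lt_one (by positivity)).2 (by linarith)⟩
  · rintro ⟨h0, h1⟩
    have : 0 < 1 - u := by linarith
    refine ⟨u / (1 - u), div_pos h0 this, ?_⟩
    simp only
    field_simp
    ring

/-- The Beta integral of the second kind, as a Mellin transform. -/
theorem hasMellin_one_add_cpow_neg {a b : ℂ} (ha : 0 < a.re) (hb : 0 < b.re) :
    HasMellin (fun x : ℝ => ((1 + x : ℝ) : ℂ) ^ (-(a + b))) a
      (Gamma a * Gamma b / Gamma (a + b)) := by
  -- The substitution `u = x / (1 + x)` maps `(0, ∞)` onto `(0, 1)` and carries the classical Beta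
  -- integrand `β` to the Mellin integrand.
  set β : ℝ → ℂ := fun u => (u : ℂ) ^ (a - 1) * (1 - (u : ℂ)) ^ (b - 1) with hβ
  have hder : ∀ x ∈ Ioi (0 : ℝ),
      HasDerivWithinAt (fun x : ℝ => x / (1 + x)) (((1 + x) ^ 2)⁻¹) (Ioi 0) x := by
    intro x hx
    have hx : 0 < x := hx
    have h := (hasDerivAt_id x).div ((hasDerivAt_id x).const_add 1) (by simp; positivity)
    refine (h.congr_deriv ?_).hasDerivWithinAt
    simp [field]
  have hinj : InjOn (fun x : ℝ => x / (1 + x)) (Ioi 0) := by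
    intro x hx y hy hxy
    have hx : 0 < x := hx
    have hy : 0 < y := hy
    simp only at hxy
    field_simp at hxy
    linarith
  have hpt : EqOn (fun x : ℝ => |((1 + x) ^ 2)⁻¹| • β (x / (1 + x)))
      (fun x : ℝ => (x : ℂ) ^ (a - 1) • ((1 + x : ℝ) : ℂ) ^ (-(a + b))) (Ioi 0) := by
    intro x hx
    have hx : 0 < x := hx
    have hy : 0 < 1 + x := by positivity
    have hyc : ((1 + x : ℝ) : ℂ) ≠ 0 := ofReal_ne_zero.2 hy.ne'
    have h1 : (1 : ℂ) - ((x / (1 + x) : ℝ) : ℂ) = (((1 + x)⁻¹ : ℝ) : ℂ) := by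
      rw [← ofReal_one, ← ofReal_sub]
      congr 1
      field_simp
      ring
    simp only [hβ]
    rw [h1, div_eq_mul_inv, ofReal_mul, mul_cpow_ofReal_nonneg hx.le (inv_nonneg.2 hy.le),
      mul_assoc, ← cpow_add _ _ (ofReal_ne_zero.2 (inv_ne_zero hy.ne')), ofReal_inv,
      inv_cpow _ _ (by rw [arg_ofReal_of_nonneg hy.le]; exact Real.pi_pos.ne), ← cpow_neg,
      abs_of_pos (by positivity), real_smul, smul_eq_mul, mul_left_comm]
    congr 1
    have h2 : ((((1 + x) ^ 2)⁻¹ : ℝ) : ℂ) = ((1 + x : ℝ) : ℂ) ^ (-2 : ℂ) := by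
      rw [cpow_neg]
      norm_cast
    rw [h2, ← cpow_add _ _ hyc]
    congr 1
    ring
  have hint : IntegrableOn β (Ioo 0 1) :=
    ((intervalIntegrable_iff_integrableOn_Ioo_of_le zero_le_one).1 (betaIntegral_convergent ha hb))
  have hval : ∫ u in Ioo (0 : ℝ) 1, β u = Gamma a * Gamma b / Gamma (a + b) := by
    rw [Gamma_mul_Gamma_eq_betaIntegral ha hb, mul_div_cancel_left₀ _
      (Gamma_ne_zero_of_re_pos (by simpa using add_pos ha hb)), betaIntegral,
      intervalIntegral.integral_of_le zero_le_one, integral_Ioc_eq_integral_Ioo]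
  rw [← image_div_one_add_Ioi] at hint hval
  constructor
  · rw [integrableOn_image_iff_integrableOn_abs_deriv_smul measurableSet_Ioi hder hinj] at hint
    exact hint.congr_fun hpt measurableSet_Ioi
  · rw [integral_image_eq_integral_abs_deriv_smul measurableSet_Ioi hder hinj,
      setIntegral_congr_fun measurableSet_Ioi hpt] at hval
    exact hval

/-! ### Mellin transform of `log (1 + x)` -/

theorem log_one_add_le_rpow {ε : ℝ} (hε : 0 < ε) {x : ℝ} (hx : 1 ≤ x) :
    Real.log (1 + x) ≤ 2 ^ ε / ε * x ^ ε := by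
  calc Real.log (1 + x) ≤ (1 + x) ^ ε / ε := Real.log_le_rpow_div (by linarith) hε
    _ ≤ (2 * x) ^ ε / ε := by gcongr; linarith
    _ = _ := by rw [Real.mul_rpow (by norm_num) (by linarith)]; ring

theorem isBigO_log_one_add_atTop {ε : ℝ} (hε : 0 < ε) :
    (fun x : ℝ => (Real.log (1 + x) : ℂ)) =O[atTop] (fun x : ℝ => x ^ ε) := by
  refine Asymptotics.IsBigO.of_bound (2 ^ ε / ε) ?_
  filter_upwards [eventually_ge_atTop 1] with x hx
  rw [norm_real, Real.norm_of_nonneg (Real.log_nonneg (by linarith)),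
    Real.norm_of_nonneg (by positivity)]
  exact log_one_add_le_rpow hε hx

theorem isBigO_log_one_add_zero :
    (fun x : ℝ => (Real.log (1 + x) : ℂ)) =O[𝓝[>] 0] (fun x : ℝ => x ^ (1 : ℝ)) := by
  refine Asymptotics.IsBigO.of_bound 1 ?_
  filter_upwards [self_mem_nhdsWithin] with x hx
  have hx : 0 < x := hx
  rw [norm_real, Real.norm_of_nonneg (Real.log_nonneg (by linarith)), Real.rpow_one,
    Real.norm_of_nonneg hx.le, one_mul]
  linarith [Real.log_le_sub_one_of_pos (show 0 < 1 + x by linarith)]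

theorem continuousOn_log_one_add :
    ContinuousOn (fun x : ℝ => (Real.log (1 + x) : ℂ)) (Ioi 0) := by
  intro x hx
  have hx : 0 < x := hx
  have : 1 + x ≠ 0 := by positivity
  exact (continuous_ofReal.continuousAt.comp (ContinuousAt.log (by fun_prop) this)).continuousWithinAt

theorem isBigO_cpow_rpow (l : Filter ℝ) (hl : ∀ᶠ x in l, 0 < x) (s : ℂ) :
    (fun x : ℝ => (x : ℂ) ^ s) =O[l] (fun x : ℝ => x ^ s.re) := by
  refine Asymptotics.IsBigO.of_bound 1 ?_
  filter_upwards [hl] with x hx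
  rw [norm_cpow_eq_rpow_re_of_pos hx, Real.norm_of_nonneg (by positivity), one_mul]

/-- Integrating by parts against `x^s / s` leaves `-1 / s` times the Beta integral with `a = 1 + s`,
`b = -s`, where `Γ(a + b) = 1`. -/
theorem hasMellin_log_one_add {s : ℂ} (h1 : -1 < s.re) (h0 : s.re < 0) :
    HasMellin (fun x : ℝ => (Real.log (1 + x) : ℂ)) s (-(Gamma (1 + s) * Gamma (-s)) / s) := by
  have hs : s ≠ 0 := by rintro rfl; simp at h0
  -- With `log (1 + x) = O(x^ε)` at infinity, this choice gives `Re s < -ε`, and the boundary term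
  -- there is `O(x^(-ε))`.
  set ε : ℝ := -s.re / 2 with hε
  have hε0 : 0 < ε := by rw [hε]; linarith
  have hconv : MellinConvergent (fun x : ℝ => (Real.log (1 + x) : ℂ)) s :=
    mellinConvergent_of_isBigO_rpow (a := -ε) (b := -1)
      (continuousOn_log_one_add.locallyIntegrableOn measurableSet_Ioi)
      (by simpa using isBigO_log_one_add_atTop hε0) (by rw [hε]; linarith)
      (by simpa using isBigO_log_one_add_zero) h1
  refine ⟨hconv, ?_⟩
  obtain ⟨hbc, hbv⟩ := hasMellin_one_add_cpow_neg (a := 1 + s) (b := -s) (by simp; linarith)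
    (by simpa using h0)
  have hpos : ∀ᶠ x : ℝ in 𝓝[>] 0, 0 < x := self_mem_nhdsWithin
  have hpt : EqOn (fun x : ℝ => (x : ℂ) ^ (1 + s - 1) • ((1 + x : ℝ) : ℂ) ^ (-(1 + s + -s)))
      (fun x : ℝ => s * ((((1 + x)⁻¹ : ℝ) : ℂ) * ((x : ℂ) ^ s / s))) (Ioi 0) := by
    intro x hx
    simp only [add_sub_cancel_left, add_neg_cancel_right, cpow_neg_one, smul_eq_mul, ofReal_inv]
    field_simp
  have hzero : Tendsto ((fun x : ℝ => (Real.log (1 + x) : ℂ)) * fun x : ℝ => (x : ℂ) ^ s / s)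
      (𝓝[>] 0) (𝓝 0) := by
    have hO := isBigO_log_one_add_zero.mul
      (((isBigO_cpow_rpow _ hpos s).const_mul_left s⁻¹))
    refine (hO.trans_tendsto ?_).congr (fun x => by simp [div_eq_inv_mul])
    have : Tendsto (fun x : ℝ => x ^ (1 + s.re)) (𝓝[>] 0) (𝓝 0) := by
      have h := (Real.continuousAt_rpow_const 0 (1 + s.re) (Or.inr (by linarith))).tendsto
      rw [Real.zero_rpow (by linarith)] at h
      exact h.mono_left nhdsWithin_le_nhds
    refine this.congr' ?_
    filter_upwards [hpos] with x hx
    rw [Real.rpow_add hx]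
  have htop : Tendsto ((fun x : ℝ => (Real.log (1 + x) : ℂ)) * fun x : ℝ => (x : ℂ) ^ s / s)
      atTop (𝓝 0) := by
    have hO := (isBigO_log_one_add_atTop hε0).mul
      (((isBigO_cpow_rpow _ (eventually_gt_atTop 0) s).const_mul_left s⁻¹))
    refine (hO.trans_tendsto ?_).congr (fun x => by simp [div_eq_inv_mul])
    refine (tendsto_rpow_neg_atTop hε0).congr' ?_
    filter_upwards [eventually_gt_atTop 0] with x hx
    rw [← Real.rpow_add hx]
    congr 1
    rw [hε]; ring
  have hibp := integral_Ioi_mul_deriv_eq_deriv_mul (a := 0) (u := fun x : ℝ => (Real.log (1 + x) : ℂ))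
    (u' := fun x : ℝ => (((1 + x)⁻¹ : ℝ) : ℂ)) (v := fun x : ℝ => (x : ℂ) ^ s / s)
    (v' := fun x : ℝ => (x : ℂ) ^ (s - 1))
    (fun x hx => by
      have hx : 0 < x := hx
      have h := ((hasDerivAt_id x).const_add 1).log (by simp; positivity)
      simpa using h.ofReal_comp)
    (fun x hx => by
      have hs1 : s - 1 ≠ -1 := fun h => hs (by linear_combination h)
      simpa using hasDerivAt_ofReal_cpow_const' (ne_of_gt hx) hs1)
    (hconv.congr_fun (fun x _ => by simp [mul_comm]) measurableSet_Ioi)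
    (IntegrableOn.congr_fun (Integrable.const_mul (hbc.congr_fun hpt measurableSet_Ioi) s⁻¹)
      (fun x _ => by simp [hs]) measurableSet_Ioi) hzero htop
  rw [mellin, setIntegral_congr_fun measurableSet_Ioi hpt, integral_const_mul, add_neg_cancel_right,
    Gamma_one, div_one] at hbv
  rw [mellin]
  simp only [smul_eq_mul, mul_comm (_ ^ _)]
  rw [hibp, ← hbv]
  field_simp
  simp

/-! ### Decay on vertical lines -/

theorem sin_sq_add_sq_le_norm_sin_sq (x y : ℝ) :
    Real.sin x ^ 2 + y ^ 2 ≤ ‖Complex.sin (x + y * I)‖ ^ 2 := by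
  have h : Complex.sin (x + y * I) =
      ((Real.sin x * Real.cosh y : ℝ) : ℂ) + ((Real.cos x * Real.sinh y : ℝ) : ℂ) * I := by
    rw [Complex.sin_add_mul_I]
    push_cast
    ring
  rw [h, Complex.sq_norm, normSq_add_mul_I]
  have h1 := Real.cosh_sq y
  have h2 := Real.sin_sq_add_cos_sq x
  have h3 : y ^ 2 ≤ Real.sinh y ^ 2 := by
    rw [sq_le_sq, Real.abs_sinh]
    exact Real.self_le_sinh_iff.2 (abs_nonneg y)
  nlinarith [sq_nonneg (Real.sinh y)]

theorem Gamma_one_add_mul_Gamma_neg (s : ℂ) :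
    Gamma (1 + s) * Gamma (-s) = -(Real.pi / Complex.sin (Real.pi * s)) := by
  have := Gamma_mul_Gamma_one_sub (-s)
  rw [sub_neg_eq_add, mul_neg, Complex.sin_neg, div_neg] at this
  rw [mul_comm, this]

/-- By reflection the transform is `π / (s sin πs)`. Both `|sin πs|²` and `|s|²` are at least `m (1
+ t²)`, so `(π / m) / (1 + t²)` dominates; the exponential decay is not needed. -/
theorem verticalIntegrable_mellin_log_one_add {c : ℝ} (h1 : -1 < c) (h0 : c < 0) :
    VerticalIntegrable (mellin fun x : ℝ => (Real.log (1 + x) : ℂ)) c := by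
  have hval : ∀ t : ℝ, mellin (fun x : ℝ => (Real.log (1 + x) : ℂ)) (c + t * I) =
      Real.pi / (Complex.sin (Real.pi * (c + t * I)) * (c + t * I)) := by
    intro t
    rw [(hasMellin_log_one_add (by simpa using h1) (by simpa using h0)).2,
      Gamma_one_add_mul_Gamma_neg, neg_neg, div_div]
  have hsinc : Real.sin (Real.pi * c) < 0 :=
    Real.sin_neg_of_neg_of_neg_pi_lt (by nlinarith [Real.pi_pos]) (by nlinarith [Real.pi_pos])
  have hlow : ∀ t : ℝ, Real.sin (Real.pi * c) ^ 2 + (Real.pi * t) ^ 2 ≤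
      ‖Complex.sin (Real.pi * (c + t * I))‖ ^ 2 := by
    intro t
    convert sin_sq_add_sq_le_norm_sin_sq (Real.pi * c) (Real.pi * t) using 4
    push_cast; ring
  have hne : ∀ t : ℝ, Complex.sin (Real.pi * (c + t * I)) * (c + t * I) ≠ 0 := by
    intro t
    refine mul_ne_zero (fun h => ?_) (fun h => ?_)
    · have := hlow t
      rw [h] at this
      simp at this
      nlinarith [sq_nonneg (Real.pi * t), sq_pos_of_neg hsinc]
    · have := congrArg re h
      simp at this
      exact h0.ne this
  set m := min (min (Real.sin (Real.pi * c) ^ 2) (c ^ 2)) 1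
  have hmpos : 0 < m := lt_min (lt_min (sq_pos_of_neg hsinc) (sq_pos_of_neg h0)) one_pos
  refine Integrable.congr (f := fun t : ℝ =>
    (Real.pi : ℂ) / (Complex.sin (Real.pi * (c + t * I)) * (c + t * I))) ?_
    (ae_of_all _ fun t => (hval t).symm)
  refine Integrable.mono' (integrable_inv_one_add_sq.const_mul (Real.pi / m))
    (Continuous.aestronglyMeasurable (continuous_const.div (by fun_prop) hne)) (ae_of_all _ ?_)
  intro t
  rw [norm_div, norm_real, Real.norm_of_nonneg Real.pi_pos.le, div_mul_eq_mul_div,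
    ← div_eq_mul_inv, div_div]
  have hsm : m ≤ Real.sin (Real.pi * c) ^ 2 := (min_le_left _ _).trans (min_le_left _ _)
  have hcm : m ≤ c ^ 2 := (min_le_left _ _).trans (min_le_right _ _)
  have h1m : m ≤ 1 := min_le_right _ _
  refine div_le_div_of_nonneg_left Real.pi_pos.le (by positivity) ?_
  have hn2 : ‖(c + t * I : ℂ)‖ ^ 2 = c ^ 2 + t ^ 2 := by
    rw [Complex.sq_norm, normSq_add_mul_I]
  rw [norm_mul]
  refine le_of_sq_le_sq ?_ (by positivity)
  rw [mul_pow, mul_pow, hn2, sq (1 + t ^ 2), sq m, mul_mul_mul_comm]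
  have ht : m * t ^ 2 ≤ t ^ 2 := by nlinarith [sq_nonneg t]
  have hpi : t ^ 2 ≤ (Real.pi * t) ^ 2 := by
    rw [mul_pow]
    exact le_mul_of_one_le_left (sq_nonneg t) (one_le_pow₀ (by linarith [Real.pi_gt_three]))
  refine mul_le_mul ?_ ?_ (by positivity) (by positivity)
  · linarith [hlow t]
  · linarith

/-! ### Parseval formula and the transform of the density -/

/-- Parseval's formula for the Mellin transform, along the line `Re s = c`. -/
theorem mellin_parseval {f g : ℝ → ℂ} {c : ℝ} (hf : MellinConvergent f c)
    (hFf : VerticalIntegrable (mellin f) c) (hfc : ContinuousOn f (Ioi 0))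
    (hg : MellinConvergent g (1 - c)) :
    IntegrableOn (fun x => f x * g x) (Ioi 0) ∧
    Integrable (fun t : ℝ => mellin f (c + t * I) * mellin g (1 - (c + t * I))) ∧
    1 / (2 * Real.pi) * ∫ t : ℝ, mellin f (c + t * I) * mellin g (1 - (c + t * I)) =
      ∫ x in Ioi 0, f x * g x := by
  -- Fubini for `K`: integrating in `t` gives `2π f(x) g(x)` by Mellin inversion, integrating in `x`
  -- gives the product of transforms.
  set K : ℝ → ℝ → ℂ := fun x t =>
    mellin f (c + t * I) * ((x : ℂ) ^ (-(c + t * I)) * g x) with hK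
  have hKint : Integrable (Function.uncurry K) ((volume.restrict (Ioi 0)).prod volume) := by
    have h1 : Integrable (fun p : ℝ × ℝ =>
        ((p.1 : ℂ) ^ ((1 : ℂ) - c - 1) • g p.1) * mellin f (c + p.2 * I))
        ((volume.restrict (Ioi 0)).prod volume) := Integrable.mul_prod hg hFf
    -- The factor `x^(-it)` is unimodular, so integrability reduces to that of a product of
    -- functions of `x` and `t` separately.
    have h2 : Integrable (fun p : ℝ × ℝ => cexp (-(p.2 * Real.log p.1 * I)) *
        (((p.1 : ℂ) ^ ((1 : ℂ) - c - 1) • g p.1) * mellin f (c + p.2 * I)))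
        ((volume.restrict (Ioi 0)).prod volume) := by
      refine h1.bdd_mul (c := 1) (Measurable.aestronglyMeasurable (by fun_prop)) (ae_of_all _ ?_)
      intro p
      rw [← ofReal_mul, ← neg_mul, ← ofReal_neg, norm_exp_ofReal_mul_I]
    refine h2.congr ?_
    have hpos : ∀ᵐ p : ℝ × ℝ ∂((volume.restrict (Ioi 0)).prod volume), 0 < p.1 :=
      Measure.quasiMeasurePreserving_fst.ae (ae_restrict_mem measurableSet_Ioi)
    filter_upwards [hpos] with p hp
    have hp' : (p.1 : ℂ) ≠ 0 := ofReal_ne_zero.2 hp.ne'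
    have : (p.1 : ℂ) ^ (-((c : ℂ) + p.2 * I)) =
        cexp (-(p.2 * Real.log p.1 * I)) * (p.1 : ℂ) ^ ((1 : ℂ) - c - 1) := by
      rw [neg_add, cpow_add _ _ hp', cpow_def_of_ne_zero hp' (-(p.2 * I)), ofReal_log hp.le,
        mul_comm]
      congr 2 <;> ring
    simp only [Function.uncurry, hK, this, smul_eq_mul]
    ring
  have hpi : (2 * Real.pi : ℂ) ≠ 0 := by
    have := Real.pi_ne_zero
    norm_cast
    positivity
  have hx : EqOn (fun x => ∫ t : ℝ, K x t) (fun x => (2 * Real.pi) * (f x * g x)) (Ioi 0) := by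
    intro x hx
    have hx : 0 < x := hx
    have hinv := mellinInv_mellin_eq c f hx hf hFf (hfc.continuousAt (Ioi_mem_nhds hx))
    rw [mellinInv, real_smul] at hinv
    simp only [hK, ← mul_assoc]
    rw [integral_mul_const, ← hinv]
    simp only [smul_eq_mul, mul_comm (mellin f _)]
    push_cast
    rw [← mul_assoc (2 * (Real.pi : ℂ)), mul_one_div_cancel hpi, one_mul]
  have ht : ∀ t : ℝ, ∫ x in Ioi 0, K x t = mellin f (c + t * I) * mellin g (1 - (c + t * I)) := by
    intro t
    simp only [hK]
    rw [integral_const_mul, mellin.eq_1 g]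
    congr 3
    ext x
    rw [smul_eq_mul]
    congr 2
    ring
  refine ⟨?_, ?_, ?_⟩
  · refine ((hKint.integral_prod_left).const_mul (2 * Real.pi : ℂ)⁻¹).congr ?_
    filter_upwards [ae_restrict_mem measurableSet_Ioi] with x hx'
    have := hx hx'
    simp only at this
    simp only [Function.uncurry]
    rw [this, inv_mul_cancel_left₀ hpi]
  · exact (hKint.integral_prod_right).congr (ae_of_all _ ht)
  · have := integral_integral_swap hKint
    rw [setIntegral_congr_fun measurableSet_Ioi hx, integral_const_mul] at this
    rw [← integral_congr_ae (ae_of_all _ ht), ← this]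
    field_simp

/-- The density is a dilation by `σ` of a multiple of `t^(k₁ - 1) (1 + t)^(-(k₁ + k₂))`. The Beta
parameters `k₁ + s - 1` and `k₂ + 1 - s` have a sum free of `s`, hence the constant denominator. -/
theorem hasMellin_betaPrimePDFReal {k₁ k₂ σ : ℝ} (hσ : 0 < σ) {s : ℂ}
    (h₁ : 0 < k₁ + s.re - 1) (h₂ : 0 < k₂ + 1 - s.re) :
    HasMellin (fun x : ℝ => (betaPrimePDFReal k₁ k₂ σ x : ℂ)) s
      ((σ : ℂ) ^ (s - 1) * Gamma (k₁ + s - 1) * Gamma (k₂ + 1 - s) /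
        ((beta k₁ k₂ * Real.Gamma (k₁ + k₂) : ℝ) : ℂ)) := by
  have hσ' : (σ : ℂ) ≠ 0 := ofReal_ne_zero.2 hσ.ne'
  have hm := hasMellin_one_add_cpow_neg (a := k₁ + s - 1) (b := k₂ + 1 - s)
    (by simpa using h₁) (by simpa using h₂)
  have hab : (k₁ + s - 1 + (k₂ + 1 - s) : ℂ) = ((k₁ + k₂ : ℝ) : ℂ) := by push_cast; ring
  rw [hab, show (k₁ + s - 1 : ℂ) = s + (k₁ - 1 : ℂ) by ring] at hm
  obtain ⟨hc, hv⟩ := hm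
  rw [← MellinConvergent.cpow_smul, ← MellinConvergent.comp_mul_left (inv_pos.2 hσ)] at hc
  rw [← mellin_cpow_smul] at hv
  set h : ℝ → ℂ := fun t => (t : ℂ) ^ (k₁ - 1 : ℂ) • ((1 + t : ℝ) : ℂ) ^ (-((k₁ + k₂ : ℝ) : ℂ))
    with hh
  set C : ℂ := ((σ * beta k₁ k₂ : ℝ) : ℂ)⁻¹ with hC
  have hpt : EqOn (fun x : ℝ => (x : ℂ) ^ (s - 1) • (C • h (σ⁻¹ * x)))
      (fun x : ℝ => (x : ℂ) ^ (s - 1) • (betaPrimePDFReal k₁ k₂ σ x : ℂ)) (Ioi 0) := by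
    intro x hx
    have hx : 0 < x := hx
    have hy : 0 ≤ σ⁻¹ * x := by positivity
    simp only [hh, betaPrimePDFReal, if_pos hx, hC, smul_eq_mul]
    rw [div_eq_inv_mul x σ, div_eq_inv_mul, ofReal_mul _ (_ * _), ofReal_mul (_ ^ _),
      ofReal_cpow hy, ofReal_cpow (by positivity), ofReal_inv, add_comm (σ⁻¹ * x)]
    push_cast
    rfl
  refine ⟨(hc.const_smul C).congr_fun hpt measurableSet_Ioi, ?_⟩
  rw [mellin, ← setIntegral_congr_fun measurableSet_Ioi hpt]
  change mellin (fun x => C • h (σ⁻¹ * x)) s = _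
  rw [mellin_const_smul, mellin_comp_mul_left _ _ (inv_pos.2 hσ), hv, hC, ofReal_inv,
    inv_cpow _ _ (by rw [arg_ofReal_of_nonneg hσ.le]; exact Real.pi_pos.ne), cpow_neg, inv_inv,
    cpow_sub _ _ hσ', cpow_one, Gamma_ofReal, show s + (k₁ - 1 : ℂ) = k₁ + s - 1 by ring]
  push_cast
  simp only [smul_eq_mul]
  field_simp

/-! ### The Meijer G-function -/

theorem meijerGIntegrand_eq_mellin_mul_mellin {kZ kW σ : ℝ} (hkZ : 0 < kZ) (hσ : 0 < σ)
    {s : ℂ} (h1 : -1 < s.re) (hW : -kW < s.re) (h0 : s.re < 0)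
    (hΛ : beta kZ kW * Real.Gamma (kZ + kW) ≠ 0) :
    meijerGIntegrand 3 2 ![0, 1 - (kW : ℂ), 1] ![0, 0, (kZ : ℂ)] ((σ⁻¹ : ℝ) : ℂ) s =
      ((beta kZ kW * Real.Gamma (kZ + kW) : ℝ) : ℂ) *
        (mellin (fun x : ℝ => (Real.log (1 + x) : ℂ)) s *
          mellin (fun x : ℝ => (betaPrimePDFReal kZ kW σ x : ℂ)) (1 - s)) := by
  have hs : s ≠ 0 := by rintro rfl; simp at h0
  -- This trades `-1 / s` for `Γ(-s) / Γ(1 - s)`, the source of the second `b = 0` and of `a = 1`.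
  have hG : Gamma (1 - s) = -s * Gamma (-s) := by
    rw [← Gamma_add_one _ (neg_ne_zero.2 hs), neg_add_eq_sub]
  have hGne : Gamma (-s) ≠ 0 := Gamma_ne_zero_of_re_pos (by simpa using h0)
  have hΛ' := ofReal_ne_zero.2 hΛ
  rw [(hasMellin_log_one_add h1 h0).2,
    (hasMellin_betaPrimePDFReal hσ (s := 1 - s) (by simp; linarith) (by simp; linarith)).2]
  simp only [meijerGIntegrand, Fin.prod_univ_three]
  simp only [Fin.isValue, Fin.val_zero, Fin.val_one, Fin.val_two, Matrix.cons_val_zero,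
    Matrix.cons_val_one, Matrix.cons_val, Nat.ofNat_pos, Nat.one_lt_ofNat, Nat.reduceLT,
    if_true, if_false, lt_self_iff_false, zero_sub, sub_zero, sub_sub_cancel, hG]
  rw [ofReal_inv,
    inv_cpow _ _ (by rw [arg_ofReal_of_nonneg hσ.le]; exact Real.pi_pos.ne), ← cpow_neg,
    show (1 - s - 1 : ℂ) = -s by ring, show (kZ + (1 - s) - 1 : ℂ) = kZ - s by ring,
    show (kW + 1 - (1 - s) : ℂ) = kW + s by ring]
  field_simp

/-- The value is unique because any two candidates are given by the same integral on one separating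
line. -/
theorem HasMeijerG.meijerG_eq {p q m n : ℕ} {a : Fin p → ℂ} {b : Fin q → ℂ} {z w : ℂ}
    (h : HasMeijerG m n a b z w) : meijerG m n a b z = w := by
  have hex : ∃ w, HasMeijerG m n a b z w := ⟨w, h⟩
  obtain ⟨c, hc⟩ := h.1
  rw [meijerG, dif_pos hex, ← (hex.choose_spec.2 c hc).2, (h.2 c hc).2]

/-! ### Beta prime law and ergodic rate -/

theorem measurable_betaPrimePDFReal (k₁ k₂ σ : ℝ) : Measurable (betaPrimePDFReal k₁ k₂ σ) :=
  Measurable.ite measurableSet_Ioi (by fun_prop) measurable_const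

theorem betaPrimePDFReal_nonneg {k₁ k₂ σ : ℝ} (hk₁ : 0 < k₁) (hk₂ : 0 < k₂) (hσ : 0 < σ) (x : ℝ) :
    0 ≤ betaPrimePDFReal k₁ k₂ σ x := by
  rw [betaPrimePDFReal]
  split_ifs with hx
  · have := beta_pos hk₁ hk₂
    positivity
  · exact le_rfl

/-- `pdf` is a Radon–Nikodym derivative, known only almost everywhere; that suffices under the
integral. -/
theorem pdf_toReal_ae_eq_betaPrimePDFReal {Ω : Type*} [MeasurableSpace Ω] {P : Measure Ω}
    {γ : Ω → ℝ} {k₁ k₂ σ : ℝ} (hk₁ : 0 < k₁) (hk₂ : 0 < k₂) (hσ : 0 < σ)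
    (hγ : HasLaw γ (betaPrimeMeasure k₁ k₂ σ) P) :
    (fun x => (pdf γ P volume x).toReal) =ᵐ[volume] betaPrimePDFReal k₁ k₂ σ := by
  rw [pdf_def, hγ.map_eq, betaPrimeMeasure]
  filter_upwards [Measure.rnDeriv_withDensity volume
    (measurable_betaPrimePDFReal k₁ k₂ σ).ennreal_ofReal] with x hx
  rw [hx, ENNReal.toReal_ofReal (betaPrimePDFReal_nonneg hk₁ hk₂ hσ x)]

/-- The expectation of `log (1 + γ)` for `γ` beta prime distributed, with its Mellin–Barnes
representation. -/
theorem integrableOn_log_one_add_mul_betaPrimePDFReal_and_hasMeijerG {kZ kW σ : ℝ}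
    (hkZ : 0 < kZ) (hkW : 0 < kW) (hσ : 0 < σ) :
    IntegrableOn (fun x => Real.log (1 + x) * betaPrimePDFReal kZ kW σ x) (Ioi 0) ∧
    HasMeijerG 3 2 ![0, 1 - (kW : ℂ), 1] ![0, 0, (kZ : ℂ)] ((σ⁻¹ : ℝ) : ℂ)
      ((beta kZ kW * Real.Gamma (kZ + kW) *
        ∫ x in Ioi 0, Real.log (1 + x) * betaPrimePDFReal kZ kW σ x : ℝ) : ℂ) := by
  have hΛ : beta kZ kW * Real.Gamma (kZ + kW) ≠ 0 :=
    (mul_pos (beta_pos hkZ hkW) (Real.Gamma_pos_of_pos (by positivity))).ne'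
  have hpars : ∀ c : ℝ, -1 < c → -kW < c → c < 0 → _ := fun c h1 hW h0 =>
    mellin_parseval (hasMellin_log_one_add (s := (c : ℂ)) (by simpa using h1) (by simpa using h0)).1
      (verticalIntegrable_mellin_log_one_add h1 h0) continuousOn_log_one_add
      (hasMellin_betaPrimePDFReal (k₁ := kZ) (k₂ := kW) hσ (s := 1 - c) (by simp; linarith)
        (by simp; linarith)).1
  obtain ⟨c₀, hc₀, hc₀'⟩ : ∃ c : ℝ, max (-1) (-kW) < c ∧ c < 0 :=
    exists_between (max_lt (by norm_num) (by linarith))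
  obtain ⟨hc₁, hc₂⟩ := max_lt_iff.1 hc₀
  refine ⟨?_, ⟨c₀, ?_, ?_⟩, ?_⟩
  · have := (hpars c₀ hc₁ hc₂ hc₀').1.re
    refine this.congr (ae_of_all _ fun x => ?_)
    simp [← ofReal_mul]
  · intro j _
    fin_cases j <;> simp <;> linarith
  · intro j hj
    fin_cases j <;> simp at hj ⊢ <;> linarith
  -- Separation yields precisely the strip where Parseval applies, and its right-hand side does not
  -- involve `c`.
  · rintro c ⟨hcr, hcl⟩
    have h0 : c < 0 := by simpa using hcr 0 (by norm_num)
    have h1 : -1 < c := by simpa using hcl 0 (by norm_num)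
    have hW : -kW < c := by simpa using hcl 1 (by norm_num)
    have hint : ∀ t : ℝ, _ := fun t => meijerGIntegrand_eq_mellin_mul_mellin (s := c + t * I) hkZ hσ
      (by simpa using h1) (by simpa using hW) (by simpa using h0) hΛ
    obtain ⟨-, hi, hv⟩ := hpars c h1 hW h0
    simp only [hint]
    refine ⟨hi.const_mul _, ?_⟩
    rw [integral_const_mul, mul_left_comm, hv, ofReal_mul (_ * _) (integral _ _),
      ← integral_complex_ofReal]
    simp only [ofReal_mul]

end

theorem mainTheorem2 {Ω : Type*} [MeasurableSpace Ω] (P : Measure Ω) [IsProbabilityMeasure P]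
    (γ : Ω → ℝ) (kZ kW θZ θW ρ ζ : ℝ)
    (hkZ : 0 < kZ) (hkW : 0 < kW) (hθZ : 0 < θZ) (hθW : 0 < θW) (hρ : 0 < ρ) (hζ : 0 < ζ)
    (hγ : HasLaw γ (betaPrimeMeasure kZ kW (ρ * ζ * θZ / θW)) P) :
    IntegrableOn (ergodicRateIntegrand γ P) (Ioi 0) ∧
    HasMeijerG 3 2 ![0, 1 - (kW : ℂ), 1] ![0, 0, (kZ : ℂ)] ((θW / (ρ * ζ * θZ) : ℝ) : ℂ)
      (meijerG 3 2 ![0, 1 - (kW : ℂ), 1] ![0, 0, (kZ : ℂ)] ((θW / (ρ * ζ * θZ) : ℝ) : ℂ)) ∧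
    (ergodicRate γ P : ℂ) =
      ((1 / (Real.log 2 * (beta kZ kW * Real.Gamma (kZ + kW))) : ℝ) : ℂ) *
        meijerG 3 2 ![0, 1 - (kW : ℂ), 1] ![0, 0, (kZ : ℂ)] ((θW / (ρ * ζ * θZ) : ℝ) : ℂ) := by
  have hσ : 0 < ρ * ζ * θZ / θW := by positivity
  obtain ⟨hint, hG⟩ := integrableOn_log_one_add_mul_betaPrimePDFReal_and_hasMeijerG hkZ hkW hσ
  rw [inv_div] at hG
  have hae : (fun x => (Real.log 2)⁻¹ *
      (Real.log (1 + x) * betaPrimePDFReal kZ kW (ρ * ζ * θZ / θW) x)) =ᵐ[volume.restrict (Ioi 0)]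
      ergodicRateIntegrand γ P := by
    filter_upwards [ae_restrict_of_ae (pdf_toReal_ae_eq_betaPrimePDFReal hkZ hkW hσ hγ)] with x hx
    rw [ergodicRateIntegrand, hx, Real.logb]
    ring
  have hΛ : beta kZ kW * Real.Gamma (kZ + kW) ≠ 0 :=
    (mul_pos (beta_pos hkZ hkW) (Real.Gamma_pos_of_pos (by positivity))).ne'
  refine ⟨(hint.const_mul _).congr hae, ?_, ?_⟩
  · rwa [hG.meijerG_eq]
  · rw [hG.meijerG_eq, ergodicRate, ← integral_congr_ae hae, integral_const_mul,
      ← Complex.ofReal_mul]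
    rw [one_div, mul_inv, mul_assoc _ _ (_ * _), inv_mul_cancel_left₀ hΛ]
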